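/- Let $n\ge 0$ be an integer, $N=\{1,\dots,n\}$, and let $$X_+=\Big\{(x,y,t)\in\{0,1\}^N\times\mathbb R_+^N\times\mathbb R_+:\ \Big(\sum_{i\in N}y_i\Big)^2\le t,\quad y_i(1-x_i)=0\ \text{ for all } i\in N\Big\}\subseteq\mathbb R^N\times\mathbb R^N\times\mathbb R .$$ For $c\in\mathbb R^N$ and $S\subseteq N$ write $c(S)=\sum_{i\in S}c_i$, and use the convention $a/0=\infty$ for $a>0$ and $0/0=0$. Then the closure of the convex hull of $X_+$ is the set of all $(x,y,t)\in\mathbb R^N\times\mathbb R^N\times\mathbb R$ that satisfy the bounds $0\le x\le 1$ and $y\ge 0$ and, for every partition $(L,R)$ of $N$ (either block may be empty), the inequality $$t\ \ge\ \min_{\mu}\ \Big\{\frac{y(L)^2}{1-x(R)+\mu(R)}+\sum_{i\in R}\frac{y_i^2}{x_i-\mu_i}\ :\ 1-x(R)+\mu(R)\ge 0,\ \ \mu_i\le x_i\ (i\in R),\ \ \mu\in\mathbb R_+^R\Big\},$$ where the minimum is taken in the extended reals and is attained whenever $0\le x\le 1$ and $y\ge 0$. -/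

import Mathlib

namespace RankOne

/-- The mixed-integer epigraph `X₊` in the space of triples `(x, y, t)`. -/
def XPlus (n : ℕ) : Set ((Fin n → ℝ) × (Fin n → ℝ) × ℝ) :=
  {p | (∀ i, p.1 i = 0 ∨ p.1 i = 1) ∧ (∀ i, 0 ≤ p.2.1 i) ∧ 0 ≤ p.2.2 ∧
    (∑ i, p.2.1 i) ^ 2 ≤ p.2.2 ∧ ∀ i, p.2.1 i * (1 - p.1 i) = 0}

/-- Division of reals with values in the extended reals, with the convention
`a / 0 = ∞` for `a > 0` and `0 / 0 = 0`. It is only used for `0 ≤ a` and `0 ≤ b`. -/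
noncomputable def extDiv (a b : ℝ) : EReal :=
  if b = 0 then (if 0 < a then ⊤ else 0) else ((a / b : ℝ) : EReal)

/-- `(L, R)` is a partition of the index set; either block may be empty. -/
def IsPartition {n : ℕ} (L R : Finset (Fin n)) : Prop :=
  Disjoint L R ∧ L ∪ R = Finset.univ

/-- The constraints on `μ ∈ ℝ^R`. -/
def feasible {n : ℕ} (R : Finset (Fin n)) (x : Fin n → ℝ) : Set (R → ℝ) :=
  {μ | 0 ≤ 1 - ∑ i ∈ R, x i + ∑ i, μ i ∧ (∀ i : R, μ i ≤ x i) ∧ ∀ i : R, 0 ≤ μ i}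

/-- The function of `μ` that is minimized. -/
noncomputable def objective {n : ℕ} (L R : Finset (Fin n)) (x y : Fin n → ℝ) (μ : R → ℝ) :
    EReal :=
  extDiv ((∑ i ∈ L, y i) ^ 2) (1 - ∑ i ∈ R, x i + ∑ i, μ i)
    + ∑ i : R, extDiv ((y i) ^ 2) (x i - μ i)

/-- The optimal value of the minimization over the feasible `μ`. -/
noncomputable def minValue {n : ℕ} (L R : Finset (Fin n)) (x y : Fin n → ℝ) : EReal :=
  sInf (objective L R x y '' feasible R x)

end RankOne

/-!
Each term `a ^ 2 / b` of the objective is the supremum over `g` of `2 * g * a - g ^ 2 * b`, so the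
objective is a supremum of functions that are affine in `(x, y, μ)`. This makes it lower
semicontinuous in `μ`, so the minimum is attained on the compact set of feasible `μ`; it also makes
each relaxation the projection of a closed convex set along compact fibres, hence closed and convex.
At a point of `X₊` the choice `μ i = x i - y i / ∑ y` makes all the ratios `a / b` equal to `∑ y`,
while the denominators sum to `1`, so the objective is `(∑ y) ^ 2`.

Conversely, a point outside the closed convex hull violates an inequality
`β · y ≤ t + α · x + δ` valid on `X₊`. Testing validity on the points of `X₊` with at most one
nonzero `y i` gives `A := δ - ∑ (α i)⁻ ≥ 0` and `γ i ^ 2 ≤ A + (α i)⁺`, where `γ i = (β i / 2)⁺`.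
Take `R = {i | √A < γ i}` and the affine minorant with slope `√A` on the block `L` and `γ i` at
`i ∈ R`. Its coefficient of `μ i` is `γ i ^ 2 - A ≥ 0`, so it is least at `μ = 0`, where it is at
least `β · y - α · x - δ`: the inequality of `(L, R)` is violated too.
-/

open Set Topology

namespace RankOne

section General

variable {ι κ E M X Y : Type*}

lemma coe_sum (s : Finset ι) (f : ι → ℝ) : ((∑ i ∈ s, f i : ℝ) : EReal) = ∑ i ∈ s, (f i : EReal) :=
  map_sum (⟨⟨Real.toEReal, EReal.coe_zero⟩, EReal.coe_add⟩ : ℝ →+ EReal) f s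

lemma eq_zero_of_forall_mul_le {K : Type*} [Field K] [LinearOrder K] [IsStrictOrderedRing K]
    {a t : K} (h : ∀ k : K, k * a ≤ t) : a = 0 := by
  by_contra ha
  have := h ((t + 1) / a)
  rw [div_mul_cancel₀ _ ha] at this
  linarith

lemma sum_filter_neg_eq [AddCommGroup M] [LinearOrder M] [IsOrderedAddMonoid M]
    (s : Finset ι) (f : ι → M) :
    ∑ i ∈ s with f i < 0, f i = -∑ i ∈ s, (f i)⁻ := by
  rw [Finset.sum_filter, ← Finset.sum_neg_distrib]
  refine Finset.sum_congr rfl fun i _ => ?_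
  split_ifs with hi
  · rw [negPart_of_nonpos hi.le, neg_neg]
  · rw [negPart_of_nonneg (not_lt.1 hi), neg_zero]

lemma sum_mul_le_dotProduct_add_sum_negPart [Fintype ι] {K : Type*} [CommRing K] [LinearOrder K]
    [IsStrictOrderedRing K] {R : Finset ι} {α c x : ι → K} (hx : x ∈ Icc 0 1)
    (hc : ∀ i ∈ R, c i ≤ (α i)⁺) :
    ∑ i ∈ R, c i * x i ≤ α ⬝ᵥ x + ∑ i, (α i)⁻ :=
  calc ∑ i ∈ R, c i * x i
      ≤ ∑ i ∈ R, (α i)⁺ * x i :=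
        Finset.sum_le_sum fun i hi => mul_le_mul_of_nonneg_right (hc i hi) (hx.1 i)
    _ ≤ ∑ i, (α i)⁺ * x i :=
        Finset.sum_le_univ_sum_of_nonneg fun i => mul_nonneg (posPart_nonneg _) (hx.1 i)
    _ ≤ ∑ i, (α i * x i + (α i)⁻) := Finset.sum_le_sum fun i _ => by
        have hx1 : (α i)⁻ * x i ≤ (α i)⁻ := mul_le_of_le_one_right (negPart_nonneg _) (hx.2 i)
        nth_rw 2 [← posPart_sub_negPart (α i)]
        linarith
    _ = α ⬝ᵥ x + ∑ i, (α i)⁻ := Finset.sum_add_distrib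

lemma isClosed_image_fst_of_mapsTo_snd [TopologicalSpace X] [TopologicalSpace Y] {s : Set (X × Y)}
    {K : Set Y} (hs : IsClosed s) (hK : IsCompact K) (hsK : MapsTo Prod.snd s K) :
    IsClosed (Prod.fst '' s) := by
  have : CompactSpace K := isCompact_iff_compactSpace.1 hK
  have himage : Prod.fst '' s = Prod.fst '' {q : X × K | (q.1, (q.2 : Y)) ∈ s} := by
    ext x
    constructor
    · rintro ⟨q, hq, rfl⟩
      exact ⟨(q.1, ⟨q.2, hsK hq⟩), hq, rfl⟩
    · rintro ⟨q, hq, rfl⟩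
      exact ⟨_, hq, rfl⟩
  rw [himage]
  exact isClosedMap_fst_of_compactSpace _ (hs.preimage (by fun_prop))

lemma dotProductEquiv_symm_dotProduct [Fintype ι] [DecidableEq ι] (g : (ι → ℝ) →ₗ[ℝ] ℝ)
    (v : ι → ℝ) : (dotProductEquiv ℝ ι).symm g ⬝ᵥ v = g v :=
  LinearMap.congr_fun ((dotProductEquiv ℝ ι).apply_symm_apply g) v

lemma exists_eq_dotProduct_add_dotProduct_add [Fintype ι] [Fintype κ]
    (f : (ι → ℝ) × (κ → ℝ) × ℝ →ₗ[ℝ] ℝ) :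
    ∃ (a : ι → ℝ) (b : κ → ℝ), ∀ p, f p = a ⬝ᵥ p.1 + b ⬝ᵥ p.2.1 + p.2.2 * f (0, 0, 1) := by
  classical
  refine ⟨(dotProductEquiv ℝ ι).symm (f ∘ₗ .inl ℝ _ _),
    (dotProductEquiv ℝ κ).symm (f ∘ₗ .inr ℝ _ _ ∘ₗ .inl ℝ _ _), fun ⟨x, y, t⟩ => ?_⟩
  have hsplit : f (x, y, t) = f (x, 0, 0) + f (0, y, 0) + t * f (0, 0, 1) := by
    rw [← smul_eq_mul, ← map_smul, ← map_add, ← map_add]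
    simp
  rw [dotProductEquiv_symm_dotProduct, dotProductEquiv_symm_dotProduct, hsplit]
  rfl

variable [AddCommGroup E] [Module ℝ E]

lemma apply_nonneg_of_forall_lt_apply_add_smul {f : E →ₗ[ℝ] ℝ} {q e : E} {u : ℝ}
    (h : ∀ r : ℝ, 0 ≤ r → u < f (q + r • e)) : 0 ≤ f e := by
  by_contra! hneg
  have hq : u < f q := by simpa using h 0 le_rfl
  have := h ((u - f q) / f e) (div_nonneg_of_nonpos (by linarith) hneg.le)
  rw [map_add, map_smul, smul_eq_mul, div_mul_cancel₀ _ hneg.ne] at this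
  linarith

lemma exists_separation_apply_eq_one [TopologicalSpace E] [IsTopologicalAddGroup E]
    [ContinuousSMul ℝ E] [LocallyConvexSpace ℝ E] {S : Set E} {e p : E}
    {height : StrongDual ℝ E} (he : height e = 1) (hS : S.Nonempty)
    (hheight : ∀ q ∈ S, 0 ≤ height q)
    (hrec : ∀ q ∈ S, ∀ r : ℝ, 0 ≤ r → q + r • e ∈ S) (hp : p ∉ closure (convexHull ℝ S)) :
    ∃ (f : StrongDual ℝ E) (c : ℝ), f e = 1 ∧ (∀ q ∈ S, c ≤ f q) ∧ f p < c := by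
  obtain ⟨f, u, hfp, hf⟩ :=
    geometric_hahn_banach_point_closed (convex_convexHull ℝ S).closure isClosed_closure hp
  have hfS (q) (hq : q ∈ S) : u < f q := hf q (subset_closure (subset_convexHull ℝ S hq))
  obtain ⟨q₀, hq₀⟩ := hS
  have hfe : 0 ≤ f e :=
    apply_nonneg_of_forall_lt_apply_add_smul (f := f.toLinearMap) fun r hr =>
      hfS _ (hrec q₀ hq₀ r hr)
  -- The separating hyperplane may contain the direction `e`; tilting it slightly repairs this.
  obtain ⟨ε, hεp, hε⟩ : ∃ ε : ℝ, f p + ε * height p < u ∧ 0 < ε := by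
    have hlim : Filter.Tendsto (fun ε : ℝ => f p + ε * height p) (𝓝[>] 0) (𝓝 (f p)) :=
      (Continuous.tendsto' (by fun_prop) 0 (f p) (by simp)).mono_left nhdsWithin_le_nhds
    exact ((hlim.eventually_lt_const hfp).and self_mem_nhdsWithin).exists
  have hpos : 0 < f e + ε := by linarith
  refine ⟨(f e + ε)⁻¹ • (f + ε • height), (f e + ε)⁻¹ * u, ?_, fun q hq => ?_, ?_⟩
  · simpa [he, mul_add] using inv_mul_cancel₀ hpos.ne'
  · exact mul_le_mul_of_nonneg_left
      ((hfS q hq).le.trans (le_add_of_nonneg_right (mul_nonneg hε.le (hheight q hq))))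
      (inv_nonneg.2 hpos.le)
  · exact mul_lt_mul_of_pos_left hεp (inv_pos.2 hpos)

end General

section Tangent

variable {ι : Type*} [Fintype ι] {a b : ι → ℝ}

/-- The value at `(a, b)` of the supporting hyperplane of the perspective function `a ^ 2 / b`
along the ray `a = g * b`. -/
def tangent (g a b : ℝ) : ℝ := 2 * g * a - g ^ 2 * b

lemma tangent_le_extDiv (g a : ℝ) {b : ℝ} (hb : 0 ≤ b) :
    (tangent g a b : EReal) ≤ extDiv (a ^ 2) b := by
  unfold extDiv tangent
  split_ifs with hb0 ha
  · exact le_top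
  · have ha0 : a = 0 := by simpa [sq_pos_iff] using ha
    simp [ha0, hb0]
  · rw [EReal.coe_le_coe_iff, le_div_iff₀ (hb.lt_of_ne' hb0)]
    nlinarith [sq_nonneg (a - g * b)]

lemma extDiv_sq_eq_tangent {a b : ℝ} (h : b = 0 → a = 0) :
    extDiv (a ^ 2) b = tangent (a / b) a b := by
  unfold extDiv tangent
  by_cases hb : b = 0
  · simp [hb, h hb]
  · rw [if_neg hb, EReal.coe_eq_coe_iff]
    field_simp
    ring

lemma tangent_mul_le (g c : ℝ) {b : ℝ} (hb : 0 ≤ b) : tangent g (c * b) b ≤ c ^ 2 * b := by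
  unfold tangent
  nlinarith [mul_nonneg hb (sq_nonneg (g - c))]

lemma sum_tangent_le_sum_extDiv (hb : 0 ≤ b) (g : ι → ℝ) :
    ((∑ i, tangent (g i) (a i) (b i) : ℝ) : EReal) ≤ ∑ i, extDiv (a i ^ 2) (b i) := by
  rw [coe_sum]
  exact Finset.sum_le_sum fun i _ => tangent_le_extDiv _ _ (hb i)

lemma sum_extDiv_le_of_forall_sum_tangent_le {t : ℝ}
    (h : ∀ g : ι → ℝ, ∑ i, tangent (g i) (a i) (b i) ≤ t) :
    ∑ i, extDiv (a i ^ 2) (b i) ≤ (t : EReal) := by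
  classical
  have hzero (j : ι) (hj : b j = 0) : a j = 0 := by
    refine eq_zero_of_forall_mul_le (t := t) fun k => ?_
    have hsum : ∑ i, tangent (Pi.single (M := fun _ => ℝ) j (k / 2) i) (a i) (b i) = k * a j := by
      rw [Fintype.sum_eq_single j fun i hij => by simp [tangent, hij]]
      simp only [tangent, Pi.single_eq_same, hj]
      ring
    exact hsum ▸ h _
  rw [Finset.sum_congr rfl fun i _ => extDiv_sq_eq_tangent (hzero i), ← coe_sum,
    EReal.coe_le_coe_iff]
  exact h fun i => a i / b i

lemma sum_extDiv_eq_iSup_sum_tangent (hb : 0 ≤ b) :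
    ∑ i, extDiv (a i ^ 2) (b i) =
      ⨆ g : ι → ℝ, ((∑ i, tangent (g i) (a i) (b i) : ℝ) : EReal) := by
  refine le_antisymm ?_ (iSup_le fun g => sum_tangent_le_sum_extDiv hb g)
  refine EReal.le_of_forall_lt_iff_le.1 fun t ht =>
    sum_extDiv_le_of_forall_sum_tangent_le fun g => EReal.coe_le_coe_iff.1 ?_
  exact (le_iSup (fun g : ι → ℝ => ((∑ i, tangent (g i) (a i) (b i) : ℝ) : EReal)) g).trans ht.le

end Tangent

variable {n : ℕ} {L R : Finset (Fin n)} {x y : Fin n → ℝ} {μ : R → ℝ}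

lemma IsPartition.sum_add_sum (h : IsPartition L R) (f : Fin n → ℝ) :
    ∑ i ∈ L, f i + ∑ i ∈ R, f i = ∑ i, f i := by
  rw [← h.2, Finset.sum_union h.1]

lemma IsPartition.dotProduct_le {u v w : Fin n → ℝ} (hLR : IsPartition L R) (hy : 0 ≤ y)
    (hL : ∀ i ∈ L, w i ≤ u i) (hR : ∀ i ∈ R, w i ≤ v i) :
    w ⬝ᵥ y ≤ ∑ i ∈ L, u i * y i + ∑ i ∈ R, v i * y i := by
  rw [dotProduct, ← hLR.sum_add_sum]
  exact add_le_add
    (Finset.sum_le_sum fun i hi => mul_le_mul_of_nonneg_right (hL i hi) (hy i))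
    (Finset.sum_le_sum fun i hi => mul_le_mul_of_nonneg_right (hR i hi) (hy i))

lemma isPartition_filter_not_filter (q : Fin n → Prop) [DecidablePred q] :
    IsPartition (Finset.univ.filter fun i => ¬ q i) (Finset.univ.filter q) :=
  ⟨(Finset.disjoint_filter_filter_not _ _ _).symm,
    (Finset.union_comm _ _).trans (Finset.filter_union_filter_not_eq _ _)⟩

/-- The numerators, before squaring, of the terms of `objective`; `none` indexes the term of the
block `L` and `some i` the term of `i ∈ R`. -/
def numerator (L R : Finset (Fin n)) (y : Fin n → ℝ) : Option R → ℝ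
  | none => ∑ i ∈ L, y i
  | some i => y i

/-- The denominators of the terms of `objective`, indexed as in `numerator`. -/
def denominator (R : Finset (Fin n)) (x : Fin n → ℝ) (μ : R → ℝ) : Option R → ℝ
  | none => 1 - ∑ i ∈ R, x i + ∑ i, μ i
  | some i => x i - μ i

/-- The minorant of `objective` with slopes `g`, affine in `(x, y, μ)`, that replaces each term by
a supporting hyperplane. -/
def minorant (L R : Finset (Fin n)) (x y : Fin n → ℝ) (μ : R → ℝ) (g : Option R → ℝ) : ℝ :=
  ∑ o, tangent (g o) (numerator L R y o) (denominator R x μ o)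

lemma objective_eq_sum_extDiv :
    objective L R x y μ = ∑ o, extDiv (numerator L R y o ^ 2) (denominator R x μ o) := by
  simp only [objective, Fintype.sum_option, numerator, denominator]

lemma mem_feasible_iff : μ ∈ feasible R x ↔ 0 ≤ denominator R x μ ∧ 0 ≤ μ := by
  simp only [feasible, mem_ofPred_eq, Pi.le_def, Option.forall, denominator, Pi.zero_apply,
    sub_nonneg, and_assoc]

lemma minorant_le_objective (hμ : μ ∈ feasible R x) (g : Option R → ℝ) :
    (minorant L R x y μ g : EReal) ≤ objective L R x y μ :=
  objective_eq_sum_extDiv ▸ sum_tangent_le_sum_extDiv (mem_feasible_iff.1 hμ).1 g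

lemma objective_le_of_forall_minorant_le {t : ℝ} (h : ∀ g, minorant L R x y μ g ≤ t) :
    objective L R x y μ ≤ (t : EReal) :=
  objective_eq_sum_extDiv ▸ sum_extDiv_le_of_forall_sum_tangent_le h

lemma objective_eq_iSup_minorant (hμ : μ ∈ feasible R x) :
    objective L R x y μ = ⨆ g, (minorant L R x y μ g : EReal) :=
  objective_eq_sum_extDiv.trans (sum_extDiv_eq_iSup_sum_tangent (mem_feasible_iff.1 hμ).1)

@[fun_prop]
lemma continuous_denominator {X : Type*} [TopologicalSpace X] {x : X → Fin n → ℝ} {μ : X → R → ℝ}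
    (hx : Continuous x) (hμ : Continuous μ) : Continuous fun z => denominator R (x z) (μ z) :=
  continuous_pi fun o => by cases o <;> simp only [denominator] <;> fun_prop

@[fun_prop]
lemma continuous_minorant {X : Type*} [TopologicalSpace X] {x y : X → Fin n → ℝ} {μ : X → R → ℝ}
    (hx : Continuous x) (hy : Continuous y) (hμ : Continuous μ) (g : Option R → ℝ) :
    Continuous fun z => minorant L R (x z) (y z) (μ z) g := by
  have hnumerator (o : Option R) : Continuous fun z => numerator L R (y z) o := by
    cases o <;> simp only [numerator] <;> fun_prop
  unfold minorant tangent
  fun_prop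

lemma minorant_eq_minorant_zero_add (μ : R → ℝ) (g : Option R → ℝ) :
    minorant L R x y μ g =
      minorant L R x y 0 g + ∑ i, (g (some i) ^ 2 - g none ^ 2) * μ i := by
  simp only [minorant, tangent, Fintype.sum_option, numerator, denominator, Pi.zero_apply,
    mul_zero, Finset.sum_const_zero, mul_sub, sub_mul, Finset.sum_sub_distrib, ← Finset.mul_sum]
  ring

lemma minorant_zero_le_minValue {g : Option R → ℝ} (hg : ∀ i, g none ^ 2 ≤ g (some i) ^ 2) :
    (minorant L R x y 0 g : EReal) ≤ minValue L R x y := by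
  refine le_sInf (forall_mem_image.2 fun μ hμ => ?_)
  refine (EReal.coe_le_coe_iff.2 ?_).trans (minorant_le_objective hμ g)
  rw [minorant_eq_minorant_zero_add μ]
  exact le_add_of_nonneg_right
    (Finset.sum_nonneg fun i _ => mul_nonneg (sub_nonneg.2 (hg i)) (hμ.2.2 i))

lemma minorant_zero_eq (g₀ : ℝ) (γ : Fin n → ℝ) :
    minorant L R x y 0 (fun o => o.elim g₀ fun i => γ i) =
      (∑ i ∈ L, 2 * g₀ * y i + ∑ i ∈ R, 2 * γ i * y i)
        - (g₀ ^ 2 + ∑ i ∈ R, (γ i ^ 2 - g₀ ^ 2) * x i) := by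
  simp only [minorant, tangent, Fintype.sum_option, numerator, denominator, Pi.zero_apply,
    Option.elim, Finset.sum_const_zero, sub_zero, sub_mul, Finset.sum_sub_distrib,
    ← Finset.mul_sum, ← Finset.sum_coe_sort R]
  ring

lemma isCompact_feasible (R : Finset (Fin n)) (x : Fin n → ℝ) : IsCompact (feasible R x) := by
  refine (isCompact_Icc (a := (0 : R → ℝ)) (b := fun i => x i)).of_isClosed_subset ?_
    fun μ hμ => ⟨hμ.2.2, hμ.2.1⟩
  have hset : feasible R x = {μ | 0 ≤ denominator R x μ} ∩ Ici 0 :=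
    ext fun _ => mem_feasible_iff
  rw [hset]
  exact (isClosed_le (by fun_prop) (by fun_prop)).inter isClosed_Ici

lemma nonempty_feasible (hx : ∀ i ∈ R, 0 ≤ x i) : (feasible R x).Nonempty := by
  refine ⟨fun i => x i, ?_, fun i => le_rfl, fun i => hx i i.2⟩
  rw [Finset.sum_coe_sort R x, sub_add_cancel]
  exact zero_le_one

lemma lowerSemicontinuousOn_objective (L R : Finset (Fin n)) (x y : Fin n → ℝ) :
    LowerSemicontinuousOn (objective L R x y) (feasible R x) := by
  have hiSup : LowerSemicontinuousOn (fun μ => ⨆ g, (minorant L R x y μ g : EReal))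
      (feasible R x) :=
    lowerSemicontinuousOn_iSup fun g =>
      (continuous_coe_real_ereal.comp (by fun_prop)).lowerSemicontinuous.lowerSemicontinuousOn _
  intro μ hμ c hc
  rw [objective_eq_iSup_minorant hμ] at hc
  filter_upwards [hiSup μ hμ c hc, self_mem_nhdsWithin] with ν hν hν_feasible
  rwa [objective_eq_iSup_minorant hν_feasible]

lemma exists_objective_eq_minValue (L : Finset (Fin n)) (y : Fin n → ℝ) (hx : ∀ i ∈ R, 0 ≤ x i) :
    ∃ μ ∈ feasible R x, objective L R x y μ = minValue L R x y := by
  obtain ⟨μ, hμ, hmin⟩ := (lowerSemicontinuousOn_objective L R x y).exists_isMinOn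
    (nonempty_feasible hx) (isCompact_feasible R x)
  refine ⟨μ, hμ, (IsLeast.csInf_eq ⟨mem_image_of_mem _ hμ, ?_⟩).symm⟩
  exact forall_mem_image.2 hmin

lemma minValue_le_coe_iff {t : ℝ} (hx : ∀ i ∈ R, 0 ≤ x i) :
    minValue L R x y ≤ (t : EReal) ↔ ∃ μ ∈ feasible R x, ∀ g, minorant L R x y μ g ≤ t := by
  constructor
  · intro h
    obtain ⟨μ, hμ, hobj⟩ := exists_objective_eq_minValue L y hx
    exact ⟨μ, hμ, fun g =>
      EReal.coe_le_coe_iff.1 ((minorant_le_objective hμ g).trans (hobj.trans_le h))⟩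
  · rintro ⟨μ, hμ, h⟩
    exact (sInf_le (mem_image_of_mem _ hμ)).trans (objective_le_of_forall_minorant_le h)

/-- The points of the box `0 ≤ x ≤ 1`, `0 ≤ y` that satisfy the inequality of the pair `(L, R)`. -/
def relaxation (L R : Finset (Fin n)) : Set ((Fin n → ℝ) × (Fin n → ℝ) × ℝ) :=
  {p | p.1 ∈ Icc 0 1 ∧ 0 ≤ p.2.1 ∧ minValue L R p.1 p.2.1 ≤ (p.2.2 : EReal)}

/-- The extended formulation of `relaxation L R`, in which the minimizer `μ` is a variable and the
bound on the objective is imposed on all of its affine minorants. -/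
def liftedRelaxation (L R : Finset (Fin n)) : Set (((Fin n → ℝ) × (Fin n → ℝ) × ℝ) × (R → ℝ)) :=
  {q | q.1.1 ∈ Icc 0 1 ∧ 0 ≤ q.1.2.1 ∧ q.2 ∈ feasible R q.1.1 ∧
    ∀ g, minorant L R q.1.1 q.1.2.1 q.2 g ≤ q.1.2.2}

lemma image_fst_liftedRelaxation (L R : Finset (Fin n)) :
    Prod.fst '' liftedRelaxation L R = relaxation L R := by
  ext p
  constructor
  · rintro ⟨⟨p, μ⟩, ⟨hx, hy, hμ, h⟩, rfl⟩
    exact ⟨hx, hy, (minValue_le_coe_iff fun i _ => hx.1 i).2 ⟨μ, hμ, h⟩⟩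
  · rintro ⟨hx, hy, h⟩
    obtain ⟨μ, hμ, h⟩ := (minValue_le_coe_iff fun i _ => hx.1 i).1 h
    exact ⟨(p, μ), ⟨hx, hy, hμ, h⟩, rfl⟩

lemma isClosed_liftedRelaxation (L R : Finset (Fin n)) : IsClosed (liftedRelaxation L R) := by
  simp only [liftedRelaxation, mem_feasible_iff, mem_Icc, ofPred_and, ofPred_forall]
  refine ((isClosed_le ?_ ?_).inter (isClosed_le ?_ ?_)).inter ((isClosed_le ?_ ?_).inter
    (((isClosed_le ?_ ?_).inter (isClosed_le ?_ ?_)).inter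
      (isClosed_iInter fun g => isClosed_le ?_ ?_))) <;> fun_prop

lemma isClosed_relaxation (L R : Finset (Fin n)) : IsClosed (relaxation L R) := by
  rw [← image_fst_liftedRelaxation]
  refine isClosed_image_fst_of_mapsTo_snd (isClosed_liftedRelaxation L R)
    (isCompact_Icc (a := 0) (b := 1)) ?_
  rintro ⟨p, μ⟩ ⟨hx, -, hμ, -⟩
  exact ⟨hμ.2.2, fun i => (hμ.2.1 i).trans (hx.2 i)⟩

lemma numerator_combo (a b : ℝ) (y y' : Fin n → ℝ) :
    numerator L R (a • y + b • y') = a • numerator L R y + b • numerator L R y' := by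
  ext (_ | i) <;> simp [numerator, Finset.sum_add_distrib, Finset.mul_sum]

lemma denominator_combo {a b : ℝ} (hab : a + b = 1) (x x' : Fin n → ℝ) (μ μ' : R → ℝ) :
    denominator R (a • x + b • x') (a • μ + b • μ') =
      a • denominator R x μ + b • denominator R x' μ' := by
  obtain rfl : b = 1 - a := by linarith
  ext (_ | i) <;>
    simp only [denominator, Pi.add_apply, Pi.smul_apply, smul_eq_mul, Finset.sum_add_distrib,
      ← Finset.mul_sum] <;>
    ring

lemma minorant_combo {a b : ℝ} (hab : a + b = 1) (x x' y y' : Fin n → ℝ) (μ μ' : R → ℝ)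
    (g : Option R → ℝ) :
    minorant L R (a • x + b • x') (a • y + b • y') (a • μ + b • μ') g =
      a * minorant L R x y μ g + b * minorant L R x' y' μ' g := by
  simp only [minorant, numerator_combo, denominator_combo hab, Finset.mul_sum,
    ← Finset.sum_add_distrib, tangent, Pi.add_apply, Pi.smul_apply, smul_eq_mul]
  exact Finset.sum_congr rfl fun o _ => by ring

lemma convex_liftedRelaxation (L R : Finset (Fin n)) : Convex ℝ (liftedRelaxation L R) := by
  rintro ⟨p, μ⟩ ⟨hx, hy, hμ, hp⟩ ⟨p', μ'⟩ ⟨hx', hy', hμ', hp'⟩ a b ha hb hab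
  rw [mem_feasible_iff] at hμ hμ'
  refine ⟨convex_Icc 0 1 hx hx' ha hb hab, convex_Ici (0 : Fin n → ℝ) hy hy' ha hb hab,
    mem_feasible_iff.2 ⟨?_, convex_Ici (0 : R → ℝ) hμ.2 hμ'.2 ha hb hab⟩, fun g => ?_⟩
  · exact (denominator_combo hab _ _ _ _).ge.trans'
      (convex_Ici (0 : Option R → ℝ) hμ.1 hμ'.1 ha hb hab)
  · exact (minorant_combo hab _ _ _ _ _ _ _).trans_le
      (add_le_add (mul_le_mul_of_nonneg_left (hp g) ha) (mul_le_mul_of_nonneg_left (hp' g) hb))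

lemma convex_relaxation (L R : Finset (Fin n)) : Convex ℝ (relaxation L R) :=
  image_fst_liftedRelaxation L R ▸ (convex_liftedRelaxation L R).linear_image (LinearMap.fst ℝ _ _)

lemma exists_weights_of_mem_XPlus {t : ℝ} (h : (x, y, t) ∈ XPlus n) :
    ∃ w : Fin n → ℝ, 0 ≤ w ∧ w ≤ x ∧ ∑ i, w i ≤ 1 ∧ ∀ i, y i = (∑ j, y j) * w i := by
  obtain ⟨hx, hy, -, -, hxy⟩ := h
  dsimp only at hx hy hxy
  have hsum : 0 ≤ ∑ j, y j := Finset.sum_nonneg fun j _ => hy j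
  have hle (i) : y i ≤ ∑ j, y j := Finset.single_le_sum (fun j _ => hy j) (Finset.mem_univ i)
  refine ⟨fun i => y i / ∑ j, y j, fun i => div_nonneg (hy i) hsum, fun i => ?_, ?_, fun i => ?_⟩
  · rcases hx i with hi | hi
    · simp [show y i = 0 by simpa [hi] using hxy i, hi]
    · exact hi ▸ div_le_one_of_le₀ (hle i) hsum
  · rw [← Finset.sum_div]
    exact div_self_le_one _
  · exact (mul_div_cancel_of_imp' fun h0 => le_antisymm (h0 ▸ hle i) (hy i)).symm

lemma sum_denominator (R : Finset (Fin n)) (x : Fin n → ℝ) (μ : R → ℝ) :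
    ∑ o, denominator R x μ o = 1 := by
  rw [Fintype.sum_option]
  simp only [denominator, Finset.sum_sub_distrib, Finset.sum_coe_sort R x]
  ring

lemma exists_feasible_numerator_eq_mul_denominator {t : ℝ} (hLR : IsPartition L R)
    (h : (x, y, t) ∈ XPlus n) :
    ∃ μ ∈ feasible R x, ∀ o, numerator L R y o = (∑ i, y i) * denominator R x μ o := by
  obtain ⟨w, hw, hwx, hw1, hyw⟩ := exists_weights_of_mem_XPlus h
  have hnone : denominator R x (fun i => x i - w i) none = 1 - ∑ i ∈ R, w i := by
    simp only [denominator, Finset.sum_coe_sort R fun i => x i - w i, Finset.sum_sub_distrib]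
    ring
  refine ⟨fun i => x i - w i, mem_feasible_iff.2 ⟨?_, fun i => sub_nonneg.2 (hwx i)⟩, ?_⟩
  · rintro (_ | i)
    · rw [hnone, Pi.zero_apply, sub_nonneg]
      exact (Finset.sum_le_univ_sum_of_nonneg hw).trans hw1
    · simpa [denominator] using hw i
  · rintro (_ | i)
    · rw [hnone, mul_sub, mul_one, Finset.mul_sum, ← Finset.sum_congr rfl fun i _ => hyw i]
      exact eq_sub_of_add_eq (hLR.sum_add_sum y)
    · simpa [numerator, denominator] using hyw i

lemma XPlus_subset_relaxation (hLR : IsPartition L R) : XPlus n ⊆ relaxation L R := by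
  rintro ⟨x, y, t⟩ h
  obtain ⟨μ, hμ, hnum⟩ := exists_feasible_numerator_eq_mul_denominator hLR h
  obtain ⟨hx, hy, -, hsq, -⟩ := h
  dsimp only at hx hy hsq
  have hx01 : x ∈ Icc 0 1 :=
    ⟨fun i => by rcases hx i with hi | hi <;> simp [hi],
      fun i => by rcases hx i with hi | hi <;> simp [hi]⟩
  refine ⟨hx01, hy, (minValue_le_coe_iff fun i _ => hx01.1 i).2 ⟨μ, hμ, fun g => ?_⟩⟩
  calc minorant L R x y μ g
      ≤ ∑ o, (∑ i, y i) ^ 2 * denominator R x μ o := Finset.sum_le_sum fun o _ =>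
        hnum o ▸ tangent_mul_le _ _ ((mem_feasible_iff.1 hμ).1 o)
    _ = (∑ i, y i) ^ 2 := by rw [← Finset.mul_sum, sum_denominator, mul_one]
    _ ≤ t := hsq

lemma closure_convexHull_XPlus_subset_relaxation (hLR : IsPartition L R) :
    closure (convexHull ℝ (XPlus n)) ⊆ relaxation L R :=
  closure_minimal (convexHull_min (XPlus_subset_relaxation hLR) (convex_relaxation L R))
    (isClosed_relaxation L R)

section ValidInequality

/-- Validity for `XPlus n` of the linear inequality `β · y ≤ t + α · x + δ`. -/
def IsValidInequality (α β : Fin n → ℝ) (δ : ℝ) : Prop :=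
  ∀ p ∈ XPlus n, β ⬝ᵥ p.2.1 ≤ p.2.2 + α ⬝ᵥ p.1 + δ

variable {α β : Fin n → ℝ} {δ : ℝ}

lemma add_smul_mem_XPlus {p : (Fin n → ℝ) × (Fin n → ℝ) × ℝ} (hp : p ∈ XPlus n) {r : ℝ}
    (hr : 0 ≤ r) : p + r • (0, 0, 1) ∈ XPlus n := by
  obtain ⟨hx, hy, ht, hsq, hxy⟩ := hp
  simp only [XPlus, mem_ofPred_eq, Prod.fst_add, Prod.snd_add, Prod.smul_mk, smul_zero,
    smul_eq_mul, mul_one, add_zero]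
  exact ⟨hx, hy, by linarith, by linarith, hxy⟩

lemma indicator_single_mem_XPlus {T : Finset (Fin n)} {i : Fin n} {s : ℝ} (hs : 0 ≤ s)
    (hi : i ∈ T) : (fun j => if j ∈ T then 1 else 0, Pi.single i s, s ^ 2) ∈ XPlus n := by
  refine ⟨fun j => ?_, fun j => ?_, sq_nonneg s, by simp, fun j => ?_⟩
  · by_cases hj : j ∈ T <;> simp [hj]
  · by_cases hj : j = i <;> simp [hj, hs]
  · by_cases hj : j = i <;> simp [hj, hi]

lemma indicator_zero_mem_XPlus (T : Finset (Fin n)) :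
    (fun j => if j ∈ T then 1 else 0, 0, 0) ∈ XPlus n := by
  refine ⟨fun j => ?_, by simp, by simp, by simp, by simp⟩
  by_cases hj : j ∈ T <;> simp [hj]

lemma exists_isValidInequality_of_notMem {p : (Fin n → ℝ) × (Fin n → ℝ) × ℝ}
    (hp : p ∉ closure (convexHull ℝ (XPlus n))) :
    ∃ (α β : Fin n → ℝ) (δ : ℝ),
      IsValidInequality α β δ ∧ p.2.2 + α ⬝ᵥ p.1 + δ < β ⬝ᵥ p.2.1 := by
  obtain ⟨f, c, hf1, hf, hfp⟩ := exists_separation_apply_eq_one (e := (0, 0, 1))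
    (height := .comp (.snd ℝ (Fin n → ℝ) ℝ) (.snd ℝ (Fin n → ℝ) _)) rfl
    ⟨_, indicator_zero_mem_XPlus ∅⟩ (fun q hq => hq.2.2.1)
    (fun q hq r hr => add_smul_mem_XPlus hq hr) hp
  obtain ⟨a, b, hab⟩ := exists_eq_dotProduct_add_dotProduct_add f.toLinearMap
  replace hab (q) : f q = a ⬝ᵥ q.1 + b ⬝ᵥ q.2.1 + q.2.2 := by simpa [hf1] using hab q
  refine ⟨a, -b, -c, fun q hq => ?_, ?_⟩
  · rw [neg_dotProduct]
    linarith [hf q hq, hab q]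
  · rw [neg_dotProduct]
    linarith [hab p]

lemma IsValidInequality.sum_add_nonneg (h : IsValidInequality α β δ) (T : Finset (Fin n)) :
    0 ≤ ∑ i ∈ T, α i + δ := by
  simpa [dotProduct] using h _ (indicator_zero_mem_XPlus T)

lemma IsValidInequality.sq_posPart_half_le (h : IsValidInequality α β δ) {T : Finset (Fin n)}
    {i : Fin n} (hi : i ∈ T) : (β i / 2)⁺ ^ 2 ≤ ∑ j ∈ T, α j + δ := by
  have hvalid : β i * (β i / 2)⁺ ≤ (β i / 2)⁺ ^ 2 + ∑ j ∈ T, α j + δ := by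
    simpa [dotProduct, Pi.single_apply] using
      h _ (indicator_single_mem_XPlus (posPart_nonneg (β i / 2)) hi)
  have hmul : β i * (β i / 2)⁺ = 2 * (β i / 2)⁺ ^ 2 := by
    rcases le_total (β i / 2) 0 with hβ | hβ
    · simp [posPart_of_nonpos hβ]
    · rw [posPart_of_nonneg hβ]
      ring
  linarith

lemma IsValidInequality.sum_negPart_le (h : IsValidInequality α β δ) : ∑ i, (α i)⁻ ≤ δ := by
  have := h.sum_add_nonneg {i | α i < 0}
  rw [sum_filter_neg_eq] at this
  linarith

lemma IsValidInequality.sq_posPart_half_le_add_posPart (h : IsValidInequality α β δ) (i : Fin n) :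
    (β i / 2)⁺ ^ 2 ≤ δ - ∑ j, (α j)⁻ + (α i)⁺ := by
  have hT := h.sq_posPart_half_le (Finset.mem_insert_self i {j | α j < 0})
  rcases lt_or_ge (α i) 0 with hi | hi
  · rw [Finset.insert_eq_of_mem (by simpa using hi), sum_filter_neg_eq] at hT
    rw [posPart_of_nonpos hi.le]
    linarith
  · rw [Finset.sum_insert (by simpa using hi), sum_filter_neg_eq] at hT
    rw [posPart_of_nonneg hi]
    linarith

lemma IsValidInequality.exists_isPartition_le_minValue (h : IsValidInequality α β δ)
    (hx : x ∈ Icc 0 1) (hy : 0 ≤ y) :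
    ∃ L R, IsPartition L R ∧ ((β ⬝ᵥ y - α ⬝ᵥ x - δ : ℝ) : EReal) ≤ minValue L R x y := by
  set A := δ - ∑ i, (α i)⁻
  set γ : Fin n → ℝ := fun i => (β i / 2)⁺
  have hA : √A ^ 2 = A := Real.sq_sqrt (sub_nonneg.2 h.sum_negPart_le)
  have hβγ (i) : β i ≤ 2 * γ i := by linarith [le_posPart (β i / 2)]
  have hpart := isPartition_filter_not_filter fun i => √A < γ i
  have hlt {i} (hi : i ∈ Finset.univ.filter fun i => √A < γ i) : √A < γ i :=
    (Finset.mem_filter.1 hi).2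
  have hβy := hpart.dotProduct_le (u := fun _ => 2 * √A) (v := fun i => 2 * γ i) hy
    (fun i hi => by linarith [hβγ i, not_lt.1 (Finset.mem_filter.1 hi).2]) fun i _ => hβγ i
  have hαx := sum_mul_le_dotProduct_add_sum_negPart (α := α) (c := fun i => γ i ^ 2 - √A ^ 2)
    (R := Finset.univ.filter fun i => √A < γ i) hx
    fun i _ => by linarith [h.sq_posPart_half_le_add_posPart i]
  refine ⟨_, _, hpart, le_trans (EReal.coe_le_coe_iff.2 ?_) (minorant_zero_le_minValue
    (g := fun o => o.elim √A fun i => γ i) fun i => ?_)⟩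
  · rw [minorant_zero_eq]
    linarith
  · exact pow_le_pow_left₀ (Real.sqrt_nonneg A) (hlt i.2).le 2

lemma mem_closure_convexHull_XPlus {t : ℝ} (hx : x ∈ Icc 0 1) (hy : 0 ≤ y)
    (h : ∀ L R, IsPartition L R → minValue L R x y ≤ (t : EReal)) :
    (x, y, t) ∈ closure (convexHull ℝ (XPlus n)) := by
  by_contra hp
  obtain ⟨α, β, δ, hvalid, hviolated⟩ := exists_isValidInequality_of_notMem hp
  obtain ⟨L, R, hLR, hle⟩ := hvalid.exists_isPartition_le_minValue hx hy
  have := EReal.coe_le_coe_iff.1 (hle.trans (h L R hLR))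
  linarith

end ValidInequality

end RankOne

theorem mainTheorem2 (n : ℕ) :
    (∀ x y : Fin n → ℝ, (∀ i, 0 ≤ x i ∧ x i ≤ 1) → (∀ i, 0 ≤ y i) →
      ∀ L R : Finset (Fin n), RankOne.IsPartition L R →
        ∃ μ ∈ RankOne.feasible R x,
          RankOne.objective L R x y μ = RankOne.minValue L R x y) ∧
    closure (convexHull ℝ (RankOne.XPlus n)) =
      {p : (Fin n → ℝ) × (Fin n → ℝ) × ℝ |
        (∀ i, 0 ≤ p.1 i ∧ p.1 i ≤ 1) ∧ (∀ i, 0 ≤ p.2.1 i) ∧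
        ∀ L R : Finset (Fin n), RankOne.IsPartition L R →
          RankOne.minValue L R p.1 p.2.1 ≤ ((p.2.2 : ℝ) : EReal)} := by
  refine ⟨fun x y hx _ L R _ => RankOne.exists_objective_eq_minValue L y fun i _ => (hx i).1,
    Subset.antisymm (fun p hp => ?_) ?_⟩
  · have hrelax (L R) (hLR : RankOne.IsPartition L R) : p ∈ RankOne.relaxation L R :=
      RankOne.closure_convexHull_XPlus_subset_relaxation hLR hp
    obtain ⟨hx, hy, -⟩ := hrelax Finset.univ ∅ (by simp [RankOne.IsPartition])
    exact ⟨fun i => ⟨hx.1 i, hx.2 i⟩, hy, fun L R hLR => (hrelax L R hLR).2.2⟩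
  · rintro p ⟨hx, hy, h⟩
    exact RankOne.mem_closure_convexHull_XPlus ⟨fun i => (hx i).1, fun i => (hx i).2⟩ hy h
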